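/- Let $n\ge 0$ be an integer, let $S^n\subset\mathbb R^{n+1}$ be the Euclidean unit sphere and let $dS$ be its rotation-invariant measure, normalized to total mass $1$. Let $SO^+(1,n+1)$ be the group of real $(n+2)\times(n+2)$ matrices $\Lambda=(\Lambda^\mu{}_\nu)_{0\le\mu,\nu\le n+1}$ that preserve the form $\mathrm{diag}(1,-1,\dots,-1)$ and satisfy $\det\Lambda=1$ and $\Lambda^0{}_0>0$. Then for every $\Lambda\in SO^+(1,n+1)$ we have $\Lambda^0{}_0+\sum_{j=1}^{n+1}\Lambda^0{}_j x^j>0$ for all $x\in S^n$; the map $\phi_\Lambda:S^n\to S^n$ given by $$\phi_\Lambda(x)^i=\frac{\Lambda^i{}_0+\sum_{j=1}^{n+1}\Lambda^i{}_j x^j}{\Lambda^0{}_0+\sum_{j=1}^{n+1}\Lambda^0{}_j x^j},\qquad i=1,\dots,n+1,$$ is a homeomorphism of $S^n$ onto itself; and the pullback $\phi_\Lambda^*(dS)$, that is, the measure $A\mapsto dS(\phi_\Lambda(A))$, is $$\phi_\Lambda^*(dS)(x)=\frac{1}{\bigl(\Lambda^0{}_0+\sum_{i=1}^{n+1}\Lambda^0{}_i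 x^i\bigr)^{n}}\,dS(x).$$ -/

import Mathlib

open MeasureTheory

/-- The Lorentz form `diag(1, -1, …, -1)` of signature `(1, n+1)`, with indices `0, 1, …, n+1`. -/
def minkowskiForm (n : ℕ) : Matrix (Fin (n + 2)) (Fin (n + 2)) ℝ :=
  Matrix.diagonal (Fin.cons 1 fun _ => -1)

/-- The group `SO⁺(1, n+1)` of proper orthochronous Lorentz matrices: they preserve the form
of signature `(1, n+1)`, have determinant one, and preserve the time direction. -/
def properLorentz (n : ℕ) : Set (Matrix (Fin (n + 2)) (Fin (n + 2)) ℝ) :=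
  {Λ | Λ.transpose * minkowskiForm n * Λ = minkowskiForm n ∧ Λ.det = 1 ∧ 0 < Λ 0 0}

/-- The unit sphere `Sⁿ` in `ℝⁿ⁺¹`. -/
abbrev unitSphere (n : ℕ) : Type := Metric.sphere (0 : EuclideanSpace ℝ (Fin (n + 1))) 1

/-- The coordinate `x'⁰ = Λ⁰₀ + ∑ⱼ Λ⁰ⱼ xʲ`. -/
noncomputable def timeCoord {n : ℕ} (Λ : Matrix (Fin (n + 2)) (Fin (n + 2)) ℝ)
    (x : unitSphere n) : ℝ :=
  Λ 0 0 + ∑ j : Fin (n + 1), Λ 0 j.succ * x.1 j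

/-- The coordinate `x'ⁱ = Λⁱ₀ + ∑ⱼ Λⁱⱼ xʲ`, for `i = 1, …, n+1`. -/
noncomputable def spaceCoord {n : ℕ} (Λ : Matrix (Fin (n + 2)) (Fin (n + 2)) ℝ)
    (x : unitSphere n) (i : Fin (n + 1)) : ℝ :=
  Λ i.succ 0 + ∑ j : Fin (n + 1), Λ i.succ j.succ * x.1 j

theorem lorentz_timeCoord_sq {n : ℕ} {Λ : Matrix (Fin (n + 2)) (Fin (n + 2)) ℝ}
    (hΛ : Λ ∈ properLorentz n) (x : unitSphere n) :
    timeCoord Λ x ^ 2 = ∑ i, spaceCoord Λ x i ^ 2 := by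
  have hx : ∑ i, x.1 i ^ 2 = 1 := by
    have h := EuclideanSpace.norm_sq_eq x.1
    rw [mem_sphere_zero_iff_norm.1 x.2] at h
    simpa using h.symm
  set v : Fin (n + 2) → ℝ := Fin.cons 1 fun j => x.1 j with hv
  have hw : Matrix.mulVec Λ v = Fin.cons (timeCoord Λ x) (spaceCoord Λ x) := by
    funext k
    refine Fin.cases ?_ (fun i => ?_) k <;>
      simp [Matrix.mulVec, dotProduct, Fin.sum_univ_succ, hv, timeCoord, spaceCoord]
  have hq : ∀ u : Fin (n + 2) → ℝ, dotProduct u (Matrix.mulVec (minkowskiForm n) u)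
      = u 0 ^ 2 - ∑ i : Fin (n + 1), u i.succ ^ 2 := by
    intro u
    simp only [minkowskiForm, Matrix.mulVec_diagonal, dotProduct, Fin.sum_univ_succ (n := n + 1),
      Fin.cons_zero, Fin.cons_succ, sub_eq_add_neg, ← Finset.sum_neg_distrib]
    congr 1
    · ring
    · exact Finset.sum_congr rfl fun i _ => by ring
  have key : dotProduct (Matrix.mulVec Λ v) (Matrix.mulVec (minkowskiForm n) (Matrix.mulVec Λ v))
      = dotProduct v (Matrix.mulVec (minkowskiForm n) v) := by
    conv_rhs => rw [← hΛ.1]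
    rw [← Matrix.mulVec_mulVec, ← Matrix.mulVec_mulVec, Matrix.dotProduct_mulVec v,
      Matrix.vecMul_transpose]
  rw [hq, hq, hw] at key
  simp only [hv, Fin.cons_zero, Fin.cons_succ, hx] at key
  linarith

theorem lorentz_timeCoord_ne_zero {n : ℕ} {Λ : Matrix (Fin (n + 2)) (Fin (n + 2)) ℝ}
    (hΛ : Λ ∈ properLorentz n) (x : unitSphere n) : timeCoord Λ x ≠ 0 := by
  intro h0
  have hs := lorentz_timeCoord_sq hΛ x
  have h1 : ∀ i, spaceCoord Λ x i = 0 := by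
    intro i
    have := (Finset.sum_eq_zero_iff_of_nonneg (fun i _ => sq_nonneg (spaceCoord Λ x i))).1
      (by rw [← hs, h0]; norm_num) i (Finset.mem_univ i)
    simpa using this
  have hw : Matrix.mulVec Λ (Fin.cons 1 fun j => x.1 j) = 0 := by
    funext k
    refine Fin.cases ?_ (fun i => ?_) k
    · simpa [Matrix.mulVec, dotProduct, Fin.sum_univ_succ, timeCoord] using h0
    · simpa [Matrix.mulVec, dotProduct, Fin.sum_univ_succ, spaceCoord] using h1 i
  have hz := Matrix.eq_zero_of_mulVec_eq_zero (by rw [hΛ.2.1]; exact one_ne_zero) hw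
  simpa using congrFun hz 0

/-- The map `φ_Λ : Sⁿ → Sⁿ`, `φ_Λ(x)ⁱ = x'ⁱ / x'⁰`. -/
noncomputable def sphereMap {n : ℕ} (Λ : Matrix (Fin (n + 2)) (Fin (n + 2)) ℝ)
    (hΛ : Λ ∈ properLorentz n) (x : unitSphere n) : unitSphere n :=
  ⟨WithLp.toLp 2 fun i => spaceCoord Λ x i / timeCoord Λ x, by
    have h := lorentz_timeCoord_ne_zero hΛ x
    rw [mem_sphere_zero_iff_norm, EuclideanSpace.norm_eq, Real.sqrt_eq_one]
    simp only [Real.norm_eq_abs, sq_abs, div_pow]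
    rw [← Finset.sum_div, ← lorentz_timeCoord_sq hΛ x, div_self (pow_ne_zero 2 h)]⟩

/-- The normalized rotation-invariant measure `dS` on `Sⁿ`: the surface measure induced by
Lebesgue measure, divided by its total mass. -/
noncomputable def sphereMeasure (n : ℕ) : Measure (unitSphere n) :=
  ((volume : Measure (EuclideanSpace ℝ (Fin (n + 1)))).toSphere Set.univ)⁻¹ •
    (volume : Measure (EuclideanSpace ℝ (Fin (n + 1)))).toSphere

/-! Write t(x) for `timeCoord Λ x`. The matrix Λ permutes light-like rays, and each ray in the
forward cone has a unique representative (1, x) with x on the sphere; `sphereMap` is this action, so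
the Lorentz inverse η Λᵀ η inverts it (`mulVec_lightVector`, `sphereMap_leftInverse`). For the
measure, parametrize the forward cone by y ↦ (‖y‖, y). Then Λ becomes a map F of ℝⁿ⁺¹ with F(r x) =
r t(x) φ(x), whose Jacobian determinant at r x is t(x) (`det_lightConeJacobian`); equivalently,
dy/‖y‖ is Lorentz invariant. The surface measure of φ(A) is n+1 times the volume of the unit cone
over φ(A), which is the F-image of {r x : x ∈ A, 0 < r < 1/t(x)}. Change of variables and polar
coordinates give (n+1) ∫_A t ∫_0^{1/t} rⁿ dr dS = ∫_A t⁻ⁿ dS. -/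

theorem minkowskiForm_mul_self (n : ℕ) : minkowskiForm n * minkowskiForm n = 1 := by
  rw [minkowskiForm, Matrix.diagonal_mul_diagonal, ← Matrix.diagonal_one]
  congr 1
  funext i
  refine Fin.cases ?_ (fun i => ?_) i <;> simp

open MeasureTheory.Measure Set Metric
open scoped Pointwise

section Lorentz

variable {n : ℕ} {Λ : Matrix (Fin (n + 2)) (Fin (n + 2)) ℝ}

/-! ### Lorentz inverse and positivity of the time coordinate -/

theorem minkowski_conj_transpose_mul (hΛ : Λ ∈ properLorentz n) :
    minkowskiForm n * Λ.transpose * minkowskiForm n * Λ = 1 := by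
  rw [Matrix.mul_assoc, Matrix.mul_assoc, ← Matrix.mul_assoc Λ.transpose, hΛ.1,
    minkowskiForm_mul_self]

theorem mul_minkowski_conj_transpose (hΛ : Λ ∈ properLorentz n) :
    Λ * (minkowskiForm n * Λ.transpose * minkowskiForm n) = 1 :=
  mul_eq_one_comm.1 (minkowski_conj_transpose_mul hΛ)

theorem mul_minkowskiForm_mul_transpose (hΛ : Λ ∈ properLorentz n) :
    Λ * minkowskiForm n * Λ.transpose = minkowskiForm n := by
  have h := congrArg (· * minkowskiForm n) (mul_minkowski_conj_transpose hΛ)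
  simpa only [Matrix.mul_assoc, minkowskiForm_mul_self, Matrix.mul_one, Matrix.one_mul] using h

theorem transpose_minkowskiForm (n : ℕ) : (minkowskiForm n).transpose = minkowskiForm n :=
  Matrix.diagonal_transpose _

/-- The inverse `η Λᵀ η` of a proper orthochronous Lorentz matrix is again one. -/
theorem minkowski_conj_transpose_mem (hΛ : Λ ∈ properLorentz n) :
    minkowskiForm n * Λ.transpose * minkowskiForm n ∈ properLorentz n := by
  refine ⟨?_, ?_, ?_⟩
  · simp only [Matrix.transpose_mul, transpose_minkowskiForm, Matrix.transpose_transpose]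
    calc _ = minkowskiForm n * (Λ * (minkowskiForm n * minkowskiForm n * minkowskiForm n)
            * Λ.transpose) * minkowskiForm n := by simp only [Matrix.mul_assoc]
      _ = _ := by
        rw [minkowskiForm_mul_self, Matrix.one_mul, mul_minkowskiForm_mul_transpose hΛ,
          minkowskiForm_mul_self, Matrix.one_mul]
  · have h := congrArg Matrix.det (mul_minkowski_conj_transpose hΛ)
    rwa [Matrix.det_mul, hΛ.2.1, one_mul, Matrix.det_one] at h
  · simpa [minkowskiForm, Matrix.mul_diagonal, Matrix.diagonal_mul] using hΛ.2.2

theorem sum_sq_eq_one_of_unitSphere (x : unitSphere n) : ∑ i, x.1 i ^ 2 = 1 := by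
  have h := EuclideanSpace.norm_sq_eq x.1
  rw [mem_sphere_zero_iff_norm.1 x.2] at h
  simpa using h.symm

theorem lorentz_zero_row_sq (hΛ : Λ ∈ properLorentz n) :
    Λ 0 0 ^ 2 = 1 + ∑ j : Fin (n + 1), Λ 0 j.succ ^ 2 := by
  have h := congrFun (congrFun (mul_minkowskiForm_mul_transpose hΛ) 0) 0
  rw [Matrix.mul_apply, Fin.sum_univ_succ] at h
  simp only [minkowskiForm, Matrix.mul_diagonal, Fin.cons_zero, Fin.cons_succ,
    Matrix.transpose_apply, Matrix.diagonal_apply_eq, mul_one, mul_neg, neg_mul,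
    Finset.sum_neg_distrib, ← sq] at h
  linarith

/-- By Cauchy–Schwarz and ‖x‖ = 1, (∑ⱼ Λ⁰ⱼ xʲ)² ≤ ∑ⱼ (Λ⁰ⱼ)² = (Λ⁰₀)² - 1, so the sum cannot outweigh
Λ⁰₀ > 0. -/
theorem timeCoord_pos (hΛ : Λ ∈ properLorentz n) (x : unitSphere n) : 0 < timeCoord Λ x := by
  have hcs := Finset.sum_mul_sq_le_sq_mul_sq Finset.univ (fun j : Fin (n + 1) => Λ 0 j.succ)
    (fun j => x.1 j)
  rw [sum_sq_eq_one_of_unitSphere, mul_one] at hcs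
  have h := lorentz_zero_row_sq hΛ
  have habs : |∑ j : Fin (n + 1), Λ 0 j.succ * x.1 j| < Λ 0 0 :=
    abs_lt_of_sq_lt_sq (by linarith) hΛ.2.2.le
  rw [timeCoord]
  linarith [(abs_lt.1 habs).1]

/-! ### Action on light-like rays -/

/-- The light-like vector `(1, x)`. -/
def lightVector (x : unitSphere n) : Fin (n + 2) → ℝ := Fin.cons 1 fun j => x.1 j

theorem mulVec_lightVector_zero (x : unitSphere n) :
    Matrix.mulVec Λ (lightVector x) 0 = timeCoord Λ x := by
  simp [Matrix.mulVec, dotProduct, Fin.sum_univ_succ, lightVector, timeCoord]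

theorem mulVec_lightVector_succ (x : unitSphere n) (i : Fin (n + 1)) :
    Matrix.mulVec Λ (lightVector x) i.succ = spaceCoord Λ x i := by
  simp [Matrix.mulVec, dotProduct, Fin.sum_univ_succ, lightVector, spaceCoord]

theorem timeCoord_mul_sphereMap (hΛ : Λ ∈ properLorentz n) (x : unitSphere n)
    (i : Fin (n + 1)) : timeCoord Λ x * (sphereMap Λ hΛ x).1 i = spaceCoord Λ x i :=
  mul_div_cancel₀ _ (lorentz_timeCoord_ne_zero hΛ x)

theorem mulVec_lightVector (hΛ : Λ ∈ properLorentz n) (x : unitSphere n) :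
    Matrix.mulVec Λ (lightVector x) = timeCoord Λ x • lightVector (sphereMap Λ hΛ x) := by
  funext k
  refine Fin.cases ?_ (fun i => ?_) k
  · rw [mulVec_lightVector_zero]
    simp [lightVector]
  · rw [mulVec_lightVector_succ, ← timeCoord_mul_sphereMap hΛ]
    simp [lightVector]

theorem eq_of_lightVector_eq_smul {x y : unitSphere n} {c : ℝ}
    (h : lightVector x = c • lightVector y) : x = y := by
  have hc : 1 = c := by simpa [lightVector] using congrFun h 0
  ext j
  simpa [lightVector, ← hc] using congrFun h j.succ

/-- Rescaling the representative of a ray does not change the ray, so the scalar factors produced by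
M and Λ are harmless, and M Λ = 1 fixes every ray. -/
theorem sphereMap_leftInverse {M : Matrix (Fin (n + 2)) (Fin (n + 2)) ℝ}
    (hΛ : Λ ∈ properLorentz n) (hM : M ∈ properLorentz n) (h : M * Λ = 1) :
    Function.LeftInverse (sphereMap M hM) (sphereMap Λ hΛ) := by
  intro x
  have h1 := mulVec_lightVector hΛ x
  have h2 := congrArg (Matrix.mulVec M) h1
  rw [Matrix.mulVec_mulVec, h, Matrix.one_mulVec, Matrix.mulVec_smul, mulVec_lightVector hM,
    smul_smul] at h2
  exact (eq_of_lightVector_eq_smul h2).symm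

theorem sphereMap_bijective (hΛ : Λ ∈ properLorentz n) :
    Function.Bijective (sphereMap Λ hΛ) :=
  ⟨(sphereMap_leftInverse hΛ (minkowski_conj_transpose_mem hΛ)
      (minkowski_conj_transpose_mul hΛ)).injective,
    (sphereMap_leftInverse (minkowski_conj_transpose_mem hΛ) hΛ
      (mul_minkowski_conj_transpose hΛ)).surjective⟩

theorem continuous_timeCoord (Λ : Matrix (Fin (n + 2)) (Fin (n + 2)) ℝ) :
    Continuous (timeCoord Λ) := by
  unfold timeCoord
  fun_prop

theorem continuous_spaceCoord (Λ : Matrix (Fin (n + 2)) (Fin (n + 2)) ℝ) (i : Fin (n + 1)) :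
    Continuous fun x : unitSphere n => spaceCoord Λ x i := by
  unfold spaceCoord
  fun_prop

theorem continuous_sphereMap (hΛ : Λ ∈ properLorentz n) : Continuous (sphereMap Λ hΛ) := by
  refine Continuous.subtype_mk ?_ _
  refine (PiLp.continuous_toLp 2 _).comp (continuous_pi fun i => ?_)
  exact (continuous_spaceCoord Λ i).div (continuous_timeCoord Λ) (lorentz_timeCoord_ne_zero hΛ)

theorem isHomeomorph_sphereMap (hΛ : Λ ∈ properLorentz n) : IsHomeomorph (sphereMap Λ hΛ) :=
  -- The sphere is compact and Hausdorff, so continuity of the inverse is automatic.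
  isHomeomorph_iff_continuous_bijective.2 ⟨continuous_sphereMap hΛ, sphereMap_bijective hΛ⟩

/-! ### The light cone map and its Jacobian -/

/-- The action of `Λ` on the forward light cone, parametrized by the space coordinates. -/
noncomputable def lightConeMap (Λ : Matrix (Fin (n + 2)) (Fin (n + 2)) ℝ)
    (y : EuclideanSpace ℝ (Fin (n + 1))) : EuclideanSpace ℝ (Fin (n + 1)) :=
  WithLp.toLp 2 fun i => Λ i.succ 0 * ‖y‖ + ∑ j : Fin (n + 1), Λ i.succ j.succ * y j

/-- The Jacobian matrix of `lightConeMap Λ` at positive multiples of `x`. -/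
def lightConeJacobian (Λ : Matrix (Fin (n + 2)) (Fin (n + 2)) ℝ) (x : unitSphere n) :
    Matrix (Fin (n + 1)) (Fin (n + 1)) ℝ :=
  Matrix.of fun i j => Λ i.succ j.succ + x.1 j * Λ i.succ 0

theorem lightConeMap_smul (hΛ : Λ ∈ properLorentz n) (x : unitSphere n) {r : ℝ} (hr : 0 < r) :
    lightConeMap Λ (r • x.1) = (r * timeCoord Λ x) • (sphereMap Λ hΛ x).1 := by
  ext i
  have hx : ‖x.1‖ = 1 := mem_sphere_zero_iff_norm.1 x.2
  rw [PiLp.smul_apply, smul_eq_mul, mul_assoc, timeCoord_mul_sphereMap, spaceCoord, mul_add,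
    Finset.mul_sum]
  simp only [lightConeMap, norm_smul, hx, Real.norm_of_nonneg hr.le, PiLp.smul_apply, smul_eq_mul]
  congr 1
  · ring
  · exact Finset.sum_congr rfl fun j _ => by ring

/-- Border the Jacobian to the matrix `B`. Subtracting xʲ times column 0 from the other columns
turns `B` into Λ with row 0 replaced by r = (1, -x). By Cramer's rule that determinant is entry 0 of
(adj Λ)ᵀ r = η Λ η r, and η r = (1, x). -/
theorem det_lightConeJacobian (hΛ : Λ ∈ properLorentz n) (x : unitSphere n) :
    (lightConeJacobian Λ x).det = timeCoord Λ x := by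
  let r : Fin (n + 2) → ℝ := Fin.cons 1 fun j => -x.1 j
  let B : Matrix (Fin (n + 2)) (Fin (n + 2)) ℝ :=
    Matrix.of (Fin.cons (Fin.cons 1 0) fun i => Fin.cons (Λ i.succ 0) (lightConeJacobian Λ x i))
  have hB : B.det = (lightConeJacobian Λ x).det := by
    rw [Matrix.det_succ_row_zero, Fin.sum_univ_succ]
    simp [B, Matrix.submatrix]
    congr 1
  have hAB : B.det = (Λ.updateRow 0 r).det := by
    rw [← Matrix.det_transpose B, ← Matrix.det_transpose (Λ.updateRow 0 r)]
    refine Matrix.det_eq_of_forall_row_eq_smul_add_const (Fin.cons 0 fun j => x.1 j) 0 rfl ?_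
    intro j i
    refine Fin.cases ?_ (fun i => ?_) i <;> refine Fin.cases ?_ (fun j => ?_) j <;>
      simp [B, r, lightConeJacobian, Matrix.updateRow_apply]
  have hadj : Λ.adjugate = minkowskiForm n * Λ.transpose * minkowskiForm n := by
    calc Λ.adjugate = Λ.adjugate * (Λ * (minkowskiForm n * Λ.transpose * minkowskiForm n)) := by
          rw [mul_minkowski_conj_transpose hΛ, Matrix.mul_one]
      _ = _ := by rw [← Matrix.mul_assoc, Matrix.adjugate_mul, hΛ.2.1, one_smul, Matrix.one_mul]
  have hr : Matrix.mulVec (minkowskiForm n) r = lightVector x := by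
    funext k
    refine Fin.cases ?_ (fun i => ?_) k <;>
      simp [minkowskiForm, Matrix.mulVec_diagonal, r, lightVector]
  rw [← hB, hAB, ← Matrix.cramer_transpose_apply, Matrix.cramer_eq_adjugate_mulVec,
    ← Matrix.adjugate_transpose, hadj]
  simp only [Matrix.transpose_mul, transpose_minkowskiForm, Matrix.transpose_transpose]
  rw [← Matrix.mul_assoc, ← Matrix.mulVec_mulVec, ← Matrix.mulVec_mulVec, hr, minkowskiForm,
    Matrix.mulVec_diagonal, mulVec_lightVector_zero, Fin.cons_zero, one_mul]

/-- The derivative of the norm depends only on the direction x, which is why the Jacobian of the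
light cone map is independent of r. -/
theorem hasFDerivAt_norm_smul_unit {E : Type*} [NormedAddCommGroup E] [InnerProductSpace ℝ E]
    {x : E} (hx : ‖x‖ = 1) {r : ℝ} (hr : 0 < r) :
    HasFDerivAt (fun y : E => ‖y‖) (innerSL ℝ x) (r • x) := by
  have h := (hasStrictFDerivAt_norm_sq (r • x)).hasFDerivAt.sqrt
    (by simp [norm_smul, hx, hr.ne'])
  simp only [Real.sqrt_sq (norm_nonneg _)] at h
  convert h using 1
  ext v
  simp [norm_smul, hx, abs_of_pos hr]
  field_simp

theorem hasFDerivAt_lightConeMap (Λ : Matrix (Fin (n + 2)) (Fin (n + 2)) ℝ) (x : unitSphere n)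
    {r : ℝ} (hr : 0 < r) :
    HasFDerivAt (lightConeMap Λ)
      (Matrix.toEuclideanLin (lightConeJacobian Λ x)).toContinuousLinearMap (r • x.1) := by
  rw [← hasFDerivWithinAt_univ, hasFDerivWithinAt_euclidean]
  intro i
  rw [hasFDerivWithinAt_univ]
  have h1 := (hasFDerivAt_norm_smul_unit (mem_sphere_zero_iff_norm.1 x.2) hr).const_mul
    (Λ i.succ 0)
  have h2 := HasFDerivAt.fun_sum (u := Finset.univ) fun (j : Fin (n + 1)) _ =>
    ((PiLp.proj 2 (fun _ : Fin (n + 1) => ℝ) j : _ →L[ℝ] ℝ).hasFDerivAt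
      (x := r • x.1)).const_mul (Λ i.succ j.succ)
  refine (h1.add h2).congr_fderiv ?_
  ext v
  simp [lightConeJacobian, Matrix.mulVec, dotProduct, add_mul, Finset.sum_add_distrib,
    PiLp.inner_apply, Finset.mul_sum]
  rw [add_comm]
  congr 1
  exact Finset.sum_congr rfl fun j _ => by ring


/-! ### Polar coordinates and the change of variables -/

/-- The cone `r x'⁰ < 1` over a subset of the sphere, in polar coordinates. -/
def timeCoordCone (Λ : Matrix (Fin (n + 2)) (Fin (n + 2)) ℝ) (A : Set (unitSphere n)) :
    Set (unitSphere n × Ioi (0 : ℝ)) :=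
  {p | p.1 ∈ A ∧ p.2.1 * timeCoord Λ p.1 < 1}

theorem measurableSet_timeCoordCone (Λ : Matrix (Fin (n + 2)) (Fin (n + 2)) ℝ)
    {A : Set (unitSphere n)} (hA : MeasurableSet A) : MeasurableSet (timeCoordCone Λ A) := by
  have hlt : MeasurableSet
      {p : unitSphere n × Ioi (0 : ℝ) | p.2.1 * timeCoord Λ p.1 < 1} := by
    refine measurableSet_lt (Continuous.measurable ?_) measurable_const
    have := continuous_timeCoord Λ
    fun_prop
  exact (measurable_fst hA).inter hlt

/-- On each ray the measure is rⁿ dr on (0, 1/t), of mass t⁻⁽ⁿ⁺¹⁾/(n+1); the Jacobian factor t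
leaves t⁻ⁿ/(n+1). -/
theorem lintegral_cone_timeCoord (hΛ : Λ ∈ properLorentz n) {A : Set (unitSphere n)}
    (hA : MeasurableSet A) (ν : Measure (unitSphere n)) [SFinite ν] :
    ∫⁻ p in timeCoordCone Λ A,
        ENNReal.ofReal (timeCoord Λ p.1) ∂(ν.prod (volumeIoiPow n)) =
      (n + 1 : ENNReal)⁻¹ * ∫⁻ x in A, ENNReal.ofReal (1 / timeCoord Λ x ^ n) ∂ν := by
  have hB := measurableSet_timeCoordCone Λ hA
  have hm : Measurable fun x : unitSphere n => ENNReal.ofReal (timeCoord Λ x) :=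
    (continuous_timeCoord Λ).measurable.ennreal_ofReal
  rw [← lintegral_indicator hB,
    lintegral_prod (indicator (timeCoordCone Λ A) fun p => ENNReal.ofReal (timeCoord Λ p.1))
    ((hm.comp measurable_fst).indicator hB).aemeasurable,
    ← lintegral_const_mul' _ _ (by simp), ← lintegral_indicator hA]
  congr 1
  funext x
  by_cases hx : x ∈ A
  · have ht := timeCoord_pos hΛ x
    have hi : (fun r : Ioi (0 : ℝ) => indicator
        (timeCoordCone Λ A)
        (fun p => ENNReal.ofReal (timeCoord Λ p.1)) (x, r)) =
        indicator (Iio ⟨1 / timeCoord Λ x, one_div_pos.2 ht⟩)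
          fun _ => ENNReal.ofReal (timeCoord Λ x) := by
      funext r
      have hiff : r.1 * timeCoord Λ x < 1 ↔ r < ⟨1 / timeCoord Λ x, one_div_pos.2 ht⟩ := by
        rw [← Subtype.coe_lt_coe, lt_div_iff₀ ht]
      simp only [indicator, timeCoordCone, mem_ofPred_eq, mem_Iio, hx, true_and, hiff]
    simp only [hi, indicator_of_mem hx]
    rw [lintegral_indicator measurableSet_Iio, setLIntegral_const, volumeIoiPow_apply_Iio,
      ← ENNReal.ofReal_mul ht.le]
    have hn : (n + 1 : ENNReal)⁻¹ = ENNReal.ofReal ((n + 1 : ℝ)⁻¹) := by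
      rw [ENNReal.ofReal_inv_of_pos (by positivity)]
      norm_cast
    rw [hn, ← ENNReal.ofReal_mul (by positivity)]
    congr 1
    simp only [one_div, inv_pow, pow_succ]
    field_simp
  · simp [indicator, timeCoordCone, hx]

/-- The map `(x, r) ↦ r x` of polar coordinates parametrizes the cone `r x'⁰ < 1` over `A`,
and `lightConeMap Λ` carries the resulting set onto the unit cone over the image of `A`. -/
theorem lightConeMap_image_cone (hΛ : Λ ∈ properLorentz n) (A : Set (unitSphere n)) :
    lightConeMap Λ '' ((fun p : unitSphere n × Ioi (0 : ℝ) => p.2.1 • p.1.1) ''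
        timeCoordCone Λ A) =
      Ioo (0 : ℝ) 1 • (Subtype.val '' (sphereMap Λ hΛ '' A)) := by
  ext z
  constructor
  · rintro ⟨_, ⟨⟨x, r, hr⟩, ⟨hx, hlt⟩, rfl⟩, rfl⟩
    rw [lightConeMap_smul hΛ x hr]
    exact smul_mem_smul ⟨mul_pos hr (timeCoord_pos hΛ x), hlt⟩
      (mem_image_of_mem _ (mem_image_of_mem _ hx))
  · rintro ⟨r, ⟨hr, hr1⟩, _, ⟨_, ⟨x, hx, rfl⟩, rfl⟩, rfl⟩
    have ht := timeCoord_pos hΛ x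
    refine ⟨_, ⟨(x, ⟨r / timeCoord Λ x, div_pos hr ht⟩), ⟨hx, ?_⟩, rfl⟩, ?_⟩
    · simpa [div_mul_cancel₀ _ ht.ne'] using hr1
    · simp only
      rw [lightConeMap_smul hΛ x (div_pos hr ht), div_mul_cancel₀ _ ht.ne']

/-- Norms of the images recover r t(x); then φ(x), hence x by bijectivity, and finally r. -/
theorem lightConeMap_injOn (hΛ : Λ ∈ properLorentz n) :
    InjOn (lightConeMap Λ) (range fun p : unitSphere n × Ioi (0 : ℝ) => p.2.1 • p.1.1) := by
  rintro _ ⟨⟨x, r, hr⟩, rfl⟩ _ ⟨⟨y, s, hs⟩, rfl⟩ h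
  rw [mem_Ioi] at hr hs
  simp only [lightConeMap_smul hΛ x hr, lightConeMap_smul hΛ y hs] at h
  have hx := mul_pos hr (timeCoord_pos hΛ x)
  have hy := mul_pos hs (timeCoord_pos hΛ y)
  have hn := congrArg norm h
  rw [norm_smul, norm_smul, mem_sphere_zero_iff_norm.1 (sphereMap Λ hΛ x).2,
    mem_sphere_zero_iff_norm.1 (sphereMap Λ hΛ y).2, Real.norm_of_nonneg hx.le,
    Real.norm_of_nonneg hy.le, mul_one, mul_one] at hn
  rw [hn] at h
  have hxy := (sphereMap_bijective hΛ).1 (Subtype.ext (smul_right_injective _ hy.ne' h))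
  subst hxy
  simp only [mul_right_cancel₀ (timeCoord_pos hΛ x).ne' hn]

theorem toSphere_image_sphereMap (hΛ : Λ ∈ properLorentz n) {A : Set (unitSphere n)}
    (hA : MeasurableSet A) :
    (volume : Measure (EuclideanSpace ℝ (Fin (n + 1)))).toSphere (sphereMap Λ hΛ '' A) =
      ∫⁻ x in A, ENNReal.ofReal (1 / timeCoord Λ x ^ n)
        ∂(volume : Measure (EuclideanSpace ℝ (Fin (n + 1)))).toSphere := by
  set E := EuclideanSpace ℝ (Fin (n + 1))
  set B : Set (unitSphere n × Ioi (0 : ℝ)) := timeCoordCone Λ A with hBdef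
  have hB : MeasurableSet B := measurableSet_timeCoordCone Λ hA
  have hemb := (isHomeomorph_sphereMap hΛ).homeomorph.measurableEmbedding
  have hφA : MeasurableSet (sphereMap Λ hΛ '' A) := hemb.measurableSet_image.2 hA
  let h := homeomorphUnitSphereProd E
  have hs : (fun p : unitSphere n × Ioi (0 : ℝ) => p.2.1 • p.1.1) '' B =
      Subtype.val '' (h ⁻¹' B) := by
    rw [← h.image_symm, image_image]
    rfl
  have hsm : MeasurableSet ((Subtype.val : ({0}ᶜ : Set E) → E) '' (h ⁻¹' B)) :=
    (MeasurableEmbedding.subtype_coe (measurableSet_singleton _).compl).measurableSet_image.2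
      (h.measurable hB)
  -- The direction y/‖y‖, extended by an arbitrary value at 0, a point outside the cone.
  let x₀ : E → unitSphere n := fun y =>
    if hy : y ∈ ({0}ᶜ : Set E) then (h ⟨y, hy⟩).1 else
      ⟨_, (NormedSpace.sphere_nonempty.2 zero_le_one : (sphere (0 : E) 1).Nonempty).some_mem⟩
  have hx₀ : ∀ z : ({0}ᶜ : Set E), x₀ z = (h z).1 := fun z => dif_pos z.2
  have hderiv : ∀ y ∈ (Subtype.val : ({0}ᶜ : Set E) → E) '' (h ⁻¹' B),
      HasFDerivWithinAt (lightConeMap Λ)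
        (Matrix.toEuclideanLin (lightConeJacobian Λ (x₀ y))).toContinuousLinearMap
        ((Subtype.val : ({0}ᶜ : Set E) → E) '' (h ⁻¹' B)) y := by
    rintro _ ⟨z, -, rfl⟩
    rw [hx₀]
    obtain ⟨⟨x, r⟩, rfl⟩ := h.symm.surjective z
    rw [h.apply_symm_apply]
    exact (hasFDerivAt_lightConeMap Λ x r.2).hasFDerivWithinAt
  have hinj : InjOn (lightConeMap Λ) ((Subtype.val : ({0}ᶜ : Set E) → E) '' (h ⁻¹' B)) := by
    rw [← hs]
    exact (lightConeMap_injOn hΛ).mono (image_subset_range _ _)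
  rw [toSphere_apply' _ hφA, ← lightConeMap_image_cone hΛ A, ← hBdef, hs,
    ← lintegral_abs_det_fderiv_eq_addHaar_image volume hsm hderiv hinj,
    ← setLIntegral_subtype (measurableSet_singleton _).compl]
  have hdet : ∀ z : ({0}ᶜ : Set E), ENNReal.ofReal
      |(Matrix.toEuclideanLin (lightConeJacobian Λ (x₀ z))).toContinuousLinearMap.det| =
        ENNReal.ofReal (timeCoord Λ (h z).1) := by
    intro z
    rw [hx₀, ContinuousLinearMap.det, LinearMap.coe_toContinuousLinearMap,
      Matrix.toEuclideanLin_eq_toLin_orthonormal, LinearMap.det_toLin,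
      det_lightConeJacobian hΛ, abs_of_pos (timeCoord_pos hΛ _)]
  simp only [hdet]
  have hmp := measurePreserving_homeomorphUnitSphereProd (volume : Measure E)
  have hdim : Module.finrank ℝ E = n + 1 := by simp [E]
  -- The radial exponent is dim E - 1 = n, and the factor dim E = n + 1 from the definition of
  -- `toSphere` cancels the one from the radial integral.
  rw [hmp.setLIntegral_comp_preimage_emb h.measurableEmbedding
    (fun p => ENNReal.ofReal (timeCoord Λ p.1)), hdim, Nat.add_sub_cancel,
    lintegral_cone_timeCoord hΛ hA, ← mul_assoc, Nat.cast_add, Nat.cast_one,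
    ENNReal.mul_inv_cancel (by simp) (by finiteness), one_mul]

end Lorentz

theorem proposition6 (n : ℕ) (Λ : Matrix (Fin (n + 2)) (Fin (n + 2)) ℝ)
    (hΛ : Λ ∈ properLorentz n) :
    (∀ x : unitSphere n, 0 < timeCoord Λ x) ∧
    IsHomeomorph (sphereMap Λ hΛ) ∧
    (sphereMeasure n).comap (sphereMap Λ hΛ) =
      (sphereMeasure n).withDensity
        (fun x => ENNReal.ofReal (1 / timeCoord Λ x ^ n)) := by
  refine ⟨timeCoord_pos hΛ, isHomeomorph_sphereMap hΛ, ?_⟩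
  ext A hA
  have hemb : MeasurableEmbedding (sphereMap Λ hΛ) :=
    (isHomeomorph_sphereMap hΛ).homeomorph.measurableEmbedding
  -- The normalizing constant multiplies both sides, so the unnormalized identity suffices.
  rw [hemb.comap_apply, sphereMeasure, withDensity_smul_measure, Measure.smul_apply,
    Measure.smul_apply, withDensity_apply _ hA, toSphere_image_sphereMap hΛ hA]
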